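/- Let $k$ be a commutative Noetherian ring and let $m \ge 1$ be an integer. Let $\mathrm{FI}$ be the category whose objects are the finite sets $[n]=\{1,\dots,n\}$, $n \ge 0$, and whose morphisms are the injections, and let $\mathrm{FI}^m$ be its $m$-fold product. An $\mathrm{FI}^m$-module over $k$ is a functor $V$ from $\mathrm{FI}^m$ to the category of $k$-modules; we write $V_{\mathbf n}$ for its value at $([n_1],\dots,[n_m])$. It is finitely generated if there are finitely many elements of $\bigsqcup_{\mathbf n} V_{\mathbf n}$ that are not all contained in any proper submodule of $V$. An element $v \in V_{\mathbf n}$ is $B$-torsion if it is in the kernel of the map $V_{\mathbf n} \to V_{\mathbf r}$ induced by some morphism $(f_1,\dots,f_m)\colon \mathbf n \to \mathbf r$ of $\mathrm{FI}^m$ with at least one $f_j$ not invertible, and $V$ is $B$-torsion if all of its elements are. The $B$-torsion elements of $V$ form a submodule $V_T$; let $H^i_B$ denote the $i$-th right derived functor of the left exact functor $V \mapsto V_T$ on the category of $\mathrm{FI}^m$-modules over $k$. If $V$ is a finitely generated $B$-torsion $\mathrm{FI}^m$-module over $k$, then $H^i_B(V) = 0$ for all $i \geq 1$. -/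

import Mathlib

open CategoryTheory CategoryTheory.Limits

universe u

/-- The objects `[n] = {1, …, n}` of the category `FI`, indexed by natural numbers. -/
structure FI : Type where
  /-- the number of elements -/
  card : ℕ

/-- Morphisms `[a] ⟶ [b]` in `FI` are the injections from an `a`-element to a `b`-element set. -/
instance FI.category : Category.{0} FI where
  Hom a b := Fin a.card ↪ Fin b.card
  id a := Function.Embedding.refl (Fin a.card)
  comp f g := Function.Embedding.trans f g

/-- The `m`-fold product category `FI^m`: objects are vectors `n = (n₁, …, n_m)` and morphisms are
`m`-tuples of injections. -/
abbrev FIPow (m : ℕ) : Type := Fin m → FI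

/-- The category of `FI^m`-modules over `k`: functors from `FI^m` to `k`-modules. -/
abbrev FIModule (k : Type u) [CommRing k] (m : ℕ) : Type (u + 1) :=
  FIPow m ⥤ ModuleCat.{u} k

namespace FIModule

/-- A morphism of `FI^m` induces transition maps when at least one of its components is not
invertible. -/
def IsTransition {m : ℕ} {a b : FIPow m} (f : a ⟶ b) : Prop :=
  ∃ j : Fin m, ¬ IsIso (f j)

variable {k : Type u} [CommRing k] {m : ℕ}

/-- An element `v ∈ V_a` is `B`-torsion if some transition map out of `V_a` kills it. -/
def IsTorsionElement (V : FIModule k m) {a : FIPow m} (v : V.obj a) : Prop :=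
  ∃ (b : FIPow m) (f : a ⟶ b), IsTransition f ∧ (V.map f).hom v = 0

/-- `V` is `B`-torsion if all of its elements are. -/
def IsTorsion (V : FIModule k m) : Prop :=
  ∀ (a : FIPow m) (v : V.obj a), IsTorsionElement V v

/-- `V` is finitely generated: there are finitely many elements of the disjoint union of the `V_a` such that every
submodule (a family of `k`-submodules of the `V_a` stable under all morphisms of `FI^m`) that
contains them is all of `V`. -/
def IsFinitelyGenerated (V : FIModule k m) : Prop :=
  ∃ S : Set (Σ a : FIPow m, V.obj a), S.Finite ∧
    ∀ W : (a : FIPow m) → Submodule k (V.obj a),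
      (∀ (a b : FIPow m) (f : a ⟶ b), ∀ v ∈ W a, (V.map f).hom v ∈ W b) →
      (∀ s ∈ S, s.2 ∈ W s.1) →
      ∀ a : FIPow m, W a = ⊤

/-! ### The `B`-torsion functor -/

/-- The standard inclusion `[a] ⟶ [b]` for `a ≤ b` componentwise. -/
def incl {a b : FIPow m} (h : ∀ j, (a j).card ≤ (b j).card) : a ⟶ b :=
  fun j => (Fin.castLEEmb (h j) : Fin (a j).card ↪ Fin (b j).card)

lemma card_le {a b : FIPow m} (f : a ⟶ b) (j : Fin m) : (a j).card ≤ (b j).card := by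
  simpa using Fintype.card_le_of_embedding (f j : Fin (a j).card ↪ Fin (b j).card)

lemma isTransition_of_lt {a b : FIPow m} (f : a ⟶ b) (j : Fin m)
    (h : (a j).card < (b j).card) : IsTransition f := by
  refine ⟨j, fun hf => ?_⟩
  have := Fintype.card_le_of_embedding (inv (f j) : Fin (b j).card ↪ Fin (a j).card)
  simp only [Fintype.card_fin] at this
  omega

lemma exists_comp_eq {a b : FIPow m} (f g : a ⟶ b) : ∃ σ : b ⟶ b, f ≫ σ = g := by
  have h : ∀ (c d : FI) (p q : Fin c.card ↪ Fin d.card), ∃ σ : Fin d.card ↪ Fin d.card,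
      p.trans σ = q := fun c d p q => by
    obtain ⟨σ, hσ⟩ := Equiv.Perm.exists_extending_pair p q p.injective q.injective
    exact ⟨σ.toEmbedding, Function.Embedding.ext hσ⟩
  choose σ hσ using fun j => h (a j) (b j) (f j) (g j)
  exact ⟨σ, funext hσ⟩

lemma map_eq_zero_of_le (V : FIModule k m) {a b c : FIPow m} {v : V.obj a} (f : a ⟶ b)
    (hf : (V.map f).hom v = 0) (h : ∀ j, (b j).card ≤ (c j).card) (g : a ⟶ c) :
    (V.map g).hom v = 0 := by
  obtain ⟨σ, rfl⟩ := exists_comp_eq (f ≫ incl h) g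
  simp [hf]

/-- The `B`-torsion elements of `V_a` form a `k`-submodule. -/
def torsionSubmodule [NeZero m] (V : FIModule k m) (a : FIPow m) : Submodule k (V.obj a) where
  carrier := {v | IsTorsionElement V v}
  zero_mem' := by
    refine ⟨fun j => ⟨(a j).card + 1⟩, incl fun j => Nat.le_succ _, ?_, map_zero _⟩
    exact isTransition_of_lt _ 0 (Nat.lt_succ_self _)
  add_mem' := by
    rintro v w ⟨b, f, -, hf⟩ ⟨c, g, -, hg⟩
    have hb := card_le f
    refine ⟨fun j => ⟨(b j).card + (c j).card + 1⟩,
      incl fun j => show _ ≤ (b j).card + (c j).card + 1 by have := hb j; omega, ?_, ?_⟩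
    · refine isTransition_of_lt _ 0 ?_
      have := hb 0
      show _ < (b 0).card + (c 0).card + 1
      omega
    · rw [map_add, map_eq_zero_of_le V f hf (fun j => ?_), map_eq_zero_of_le V g hg (fun j => ?_),
        add_zero]
      · show _ ≤ (b j).card + (c j).card + 1
        omega
      · show _ ≤ (b j).card + (c j).card + 1
        omega
  smul_mem' := by
    rintro r v ⟨b, f, ht, hf⟩
    exact ⟨b, f, ht, by rw [map_smul, hf, smul_zero]⟩

lemma map_mem_torsionSubmodule [NeZero m] (V : FIModule k m) {a b : FIPow m} (h : a ⟶ b)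
    (v : V.obj a) (hv : v ∈ torsionSubmodule V a) :
    (V.map h).hom v ∈ torsionSubmodule V b := by
  obtain ⟨c, f, -, hf⟩ := hv
  let d : FIPow m := fun j => ⟨(b j).card + (c j).card + 1⟩
  have hbd : ∀ j, (b j).card ≤ (d j).card := fun j => by simp only [d]; omega
  have hcd : ∀ j, (c j).card ≤ (d j).card := fun j => by simp only [d]; omega
  refine ⟨d, incl hbd, isTransition_of_lt _ 0 (by simp only [d]; omega), ?_⟩
  simpa using map_eq_zero_of_le V f hf hcd (h ≫ incl hbd)

lemma app_mem_torsionSubmodule [NeZero m] {V W : FIModule k m} (φ : V ⟶ W) {a : FIPow m}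
    (v : V.obj a) (hv : v ∈ torsionSubmodule V a) :
    (φ.app a).hom v ∈ torsionSubmodule W a := by
  obtain ⟨c, f, ht, hf⟩ := hv
  refine ⟨c, f, ht, ?_⟩
  have h := congrArg (fun g => g.hom v) (φ.naturality f)
  simp only [ModuleCat.hom_comp, LinearMap.comp_apply] at h
  rw [← h, hf, map_zero]

/-- The maximal `B`-torsion submodule `V_T` of `V`, as an `FI^m`-module. -/
def torsionPart [NeZero m] (V : FIModule k m) : FIModule k m where
  obj a := ModuleCat.of k (torsionSubmodule V a)
  map f := ModuleCat.ofHom ((V.map f).hom.restrict (map_mem_torsionSubmodule V f))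
  map_id a := by
    ext v
    exact congrArg (fun g => g.hom v.1) (V.map_id a)
  map_comp f g := by
    ext v
    exact congrArg (fun h => h.hom v.1) (V.map_comp f g)

variable (k m)

/-- The `B`-torsion functor `V ↦ V_T`. -/
def torsionFunctor [NeZero m] : FIModule k m ⥤ FIModule k m where
  obj V := torsionPart V
  map φ :=
    { app := fun a =>
        ModuleCat.ofHom ((φ.app a).hom.restrict (app_mem_torsionSubmodule φ))
      naturality := fun a b f => by
        ext v
        exact Subtype.ext (congrArg (fun g => g.hom v.1) (φ.naturality f)) }
  map_id V := by ext a v; exact Subtype.ext rfl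
  map_comp φ ψ := by ext a v; exact Subtype.ext rfl

instance torsionFunctor_additive [NeZero m] : (torsionFunctor k m).Additive where
  map_add {V W φ ψ} := by ext a v; exact Subtype.ext rfl

/-! ### Local cohomology -/

instance hasSeparator : HasSeparator (FIModule k m) :=
  HasSeparator.of_equivalence ((opOpEquivalence (FIPow m)).congrLeft (E := ModuleCat.{u} k))

instance ab5 : AB5OfSize.{u, u} (FIModule k m) where
  ofShape K _ _ := by infer_instance

/-- `FI^m`-modules form a Grothendieck abelian category; in particular there are enough
injectives. -/
instance isGrothendieckAbelian : IsGrothendieckAbelian.{u} (FIModule k m) where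

/-- The local cohomology functor `H^i_B`: the `i`-th right derived functor of the `B`-torsion
functor. -/
noncomputable def localCohomology [NeZero m] (i : ℕ) : FIModule k m ⥤ FIModule k m :=
  (torsionFunctor k m).rightDerived i

end FIModule

/-! Each of the finitely many generators of `V` dies in some degree, hence under every morphism to a
larger degree, so `V` vanishes in all degrees above some `b`. Let `P` be the degrees not above `b`.
Then `V` is the extension by zero of its restriction to `P`. Extension by zero is exact and
preserves injectives, so an injective resolution over `P` extends to one of `V`. All its terms
vanish above `b` and are therefore torsion; the torsion functor leaves this resolution unchanged up
to isomorphism, and it stays exact in positive degrees. -/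

namespace CategoryTheory

/-! ### Derived functors and exact functors preserving injectives -/

section DerivedFunctors

variable {A B C : Type*} [Category* A] [Category* B] [Category* C]
  [Abelian A] [Abelian B] [Abelian C]

/-- The image of an injective resolution under an exact functor that preserves injectives. -/
noncomputable def InjectiveResolution.mapExact {X : A} (I : InjectiveResolution X) (G : A ⥤ B)
    [G.Additive] [G.PreservesHomology] (hG : ∀ J : A, Injective J → Injective (G.obj J)) :
    InjectiveResolution (G.obj X) where
  cocomplex := (G.mapHomologicalComplex _).obj I.cocomplex
  injective n := hG _ (I.injective n)
  ι := ((HomologicalComplex.singleMapHomologicalComplex G (ComplexShape.up ℕ) 0).inv.app X) ≫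
    (G.mapHomologicalComplex _).map I.ι
  quasiIso := inferInstance

/-- If `G` is exact and preserves injectives and `G ⋙ F` is isomorphic to an exact functor, then the
higher right derived functors of `F` vanish on the image of `G`. -/
theorem Functor.isZero_rightDerived_succ_obj_of_comp_iso
    [HasInjectiveResolutions A] [HasInjectiveResolutions B]
    (G : A ⥤ B) [G.Additive] [G.PreservesHomology]
    (hG : ∀ J : A, Injective J → Injective (G.obj J))
    (F : B ⥤ C) [F.Additive] (E : A ⥤ C) [E.Additive] [E.PreservesHomology] (e : G ⋙ F ≅ E)
    (X : A) (n : ℕ) :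
    IsZero ((F.rightDerived (n + 1)).obj (G.obj X)) := by
  let I : InjectiveResolution X := (HasInjectiveResolution.out (Z := X)).some
  refine IsZero.of_iso ?_ ((I.mapExact G hG).isoRightDerivedObj F (n + 1))
  erw [← HomologicalComplex.exactAt_iff_isZero_homology]
  -- Through `e`, the complex is the image under the exact functor `E` of a resolution, which is
  -- exact in degree `n + 1`.
  exact ShortComplex.exact_of_iso (ShortComplex.mapNatIso _ e.symm)
    (ShortComplex.Exact.map (I.cocomplex_exactAt_succ n) E)

end DerivedFunctors

/-! ### Extension by zero -/

section ExtendByZero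

/-- Functors from a small category to modules have enough injectives. -/
lemma enoughInjectives_functor_moduleCat (k : Type u) [CommRing k] (J : Type) [Category.{0} J] :
    EnoughInjectives (J ⥤ ModuleCat.{u} k) := by
  have : HasSeparator (J ⥤ ModuleCat.{u} k) :=
    HasSeparator.of_equivalence ((opOpEquivalence J).congrLeft (E := ModuleCat.{u} k))
  have : AB5OfSize.{u, u} (J ⥤ ModuleCat.{u} k) := ⟨fun K _ _ => inferInstance⟩
  have : IsGrothendieckAbelian.{u} (J ⥤ ModuleCat.{u} k) := { }
  infer_instance

variable {J : Type} [Category.{0} J] {k : Type u} [CommRing k] (P : ObjectProperty J)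
  (hP : ∀ ⦃a b : J⦄, (a ⟶ b) → P b → P a)

/-- Extension by zero of a functor defined on a full subcategory that is closed under sources of
morphisms: the value at `a` is the given one if `P a` holds, and zero otherwise. -/
def extendByZeroObj (W : P.FullSubcategory ⥤ ModuleCat.{u} k) : J ⥤ ModuleCat.{u} k where
  -- A product indexed by the proofs of `P a`: one factor if `P a` holds, the empty product
  -- otherwise. This avoids a case split.
  obj a := ModuleCat.of k (∀ h : PLift (P a), W.obj ⟨a, h.down⟩)
  map {a b} f := ModuleCat.ofHom
    (LinearMap.pi fun h => (W.map (X := ⟨a, hP f h.down⟩) (Y := ⟨b, h.down⟩)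
      (ObjectProperty.homMk f)).hom ∘ₗ LinearMap.proj ⟨hP f h.down⟩)
  map_id a := by
    refine ModuleCat.hom_ext (LinearMap.ext fun x => funext fun h => ?_)
    exact congrArg (fun g => g.hom (x h)) (W.map_id ⟨a, h.down⟩)
  map_comp {a b c} f g := by
    refine ModuleCat.hom_ext (LinearMap.ext fun x => funext fun h => ?_)
    exact congrArg (fun q => q.hom (x ⟨hP f (hP g h.down)⟩))
      (W.map_comp (X := ⟨a, hP f (hP g h.down)⟩) (Y := ⟨b, hP g h.down⟩) (Z := ⟨c, h.down⟩)
        (ObjectProperty.homMk f) (ObjectProperty.homMk g))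

/-- Extension by zero, as a functor. -/
def extendByZero : (P.FullSubcategory ⥤ ModuleCat.{u} k) ⥤ (J ⥤ ModuleCat.{u} k) where
  obj W := extendByZeroObj P hP W
  map {W W'} φ :=
    { app := fun a => ModuleCat.ofHom
        (LinearMap.pi fun h => (φ.app ⟨a, h.down⟩).hom ∘ₗ LinearMap.proj h)
      naturality := fun a b f => by
        refine ModuleCat.hom_ext (LinearMap.ext fun x => funext fun h => ?_)
        exact congrArg (fun q => q.hom (x ⟨hP f h.down⟩))
          (φ.naturality (X := ⟨a, hP f h.down⟩) (Y := ⟨b, h.down⟩) (ObjectProperty.homMk f)) }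
  map_id W := by ext a x; rfl
  map_comp φ ψ := by ext a x; rfl

/-- Restriction to a full subcategory closed under sources is left adjoint to extension by
zero. -/
def restrictExtendByZeroAdjunction :
    (Functor.whiskeringLeft _ _ (ModuleCat.{u} k)).obj P.ι ⊣ extendByZero (k := k) P hP :=
  Adjunction.mkOfUnitCounit
    { unit :=
        { app := fun V =>
            { app := fun a => ModuleCat.ofHom (LinearMap.pi fun _ => LinearMap.id)
              naturality := fun a b f => by ext x; rfl }
          naturality := fun V W φ => by ext a x; rfl }
      counit :=
        { app := fun W =>
            { app := fun a => ModuleCat.ofHom (LinearMap.proj ⟨a.property⟩)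
              naturality := fun a b f => by ext x; rfl }
          naturality := fun V W φ => by ext a x; rfl }
      left_triangle := by ext V a x; rfl
      right_triangle := by ext V a x; rfl }

instance extendByZero_additive : (extendByZero (k := k) P hP).Additive where
  map_add := by intros; ext a x; rfl

instance extendByZero_preservesEpimorphisms :
    (extendByZero (k := k) P hP).PreservesEpimorphisms where
  preserves {W W'} φ hφ := by
    rw [NatTrans.epi_iff_epi_app]
    intro a
    rw [ModuleCat.epi_iff_surjective]
    intro y
    have h (h : PLift (P a)) : Function.Surjective (φ.app ⟨a, h.down⟩) :=
      (ModuleCat.epi_iff_surjective _).1 inferInstance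
    choose x hx using fun h' => h h' (y h')
    exact ⟨x, funext hx⟩

instance extendByZero_preservesHomology : (extendByZero (k := k) P hP).PreservesHomology := by
  have := (restrictExtendByZeroAdjunction (k := k) P hP).isRightAdjoint
  exact Functor.preservesHomology_of_preservesEpis_and_kernels _

/-- The left adjoint is restriction, which preserves monomorphisms because these are detected
pointwise. -/
lemma injective_extendByZero_obj (W : P.FullSubcategory ⥤ ModuleCat.{u} k) (hW : Injective W) :
    Injective ((extendByZero P hP).obj W) :=
  (restrictExtendByZeroAdjunction (k := k) P hP).map_injective W hW

/-- A functor that vanishes outside of `P` is the extension by zero of its restriction. -/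
lemma isIso_unit_app_of_isZero (V : J ⥤ ModuleCat.{u} k)
    (hV : ∀ a, ¬ P a → Subsingleton (V.obj a)) :
    IsIso ((restrictExtendByZeroAdjunction (k := k) P hP).unit.app V) := by
  rw [NatTrans.isIso_iff_isIso_app]
  intro a
  rw [ConcreteCategory.isIso_iff_bijective]
  by_cases ha : P a
  · exact ⟨fun x y h => congrFun h ⟨ha⟩, fun y => ⟨y ⟨ha⟩, rfl⟩⟩
  · have := hV a ha
    exact ⟨fun x y _ => this.elim x y, fun y => ⟨0, funext fun h => (ha h.down).elim⟩⟩

end ExtendByZero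

end CategoryTheory

/-! ### Vanishing in large degrees and torsion -/

namespace FIModule

variable {k : Type u} [CommRing k] {m : ℕ}

/-- The vectors that do not dominate `b` componentwise. -/
def notAbove (b : FIPow m) : ObjectProperty (FIPow m) :=
  fun a => ¬ ∀ j, (b j).card ≤ (a j).card

lemma notAbove_of_hom (b : FIPow m) ⦃a c : FIPow m⦄ (f : a ⟶ c) (hc : notAbove b c) :
    notAbove b a :=
  fun h => hc fun j => (h j).trans (card_le f j)

/-- Every element of a module vanishing in all degrees above `b` is torsion. -/
lemma isTorsion_of_subsingleton [NeZero m] (V : FIModule k m) (b : FIPow m)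
    (hV : ∀ a, ¬ notAbove b a → Subsingleton (V.obj a)) : IsTorsion V := by
  intro a v
  -- The `+ 1` makes the inclusion non-invertible even when `b` is zero.
  let d : FIPow m := fun j => ⟨(a j).card + (b j).card + 1⟩
  have had : ∀ j, (a j).card ≤ (d j).card := fun j => by simp only [d]; omega
  have := hV d (not_not.2 fun j => by simp only [d]; omega)
  exact ⟨d, incl had, isTransition_of_lt _ 0 (by simp only [d]; omega), Subsingleton.elim _ _⟩

variable (k) in
/-- The torsion functor restricts to the identity on extensions by zero from degrees not
above `b`. -/
noncomputable def extendByZeroTorsionIso [NeZero m] (b : FIPow m) :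
    extendByZero (k := k) (notAbove b) (notAbove_of_hom b) ⋙ torsionFunctor k m ≅
      extendByZero (notAbove b) (notAbove_of_hom b) :=
  NatIso.ofComponents
    (fun W => NatIso.ofComponents
      (fun a => (LinearEquiv.ofTop (torsionSubmodule _ a) (Submodule.eq_top_iff'.2
        (isTorsion_of_subsingleton (extendByZeroObj (notAbove b) (notAbove_of_hom b) W) b
          (fun c hc => ⟨fun x y => funext fun h => (hc h.down).elim⟩) a))).toModuleIso)
      (fun f => by ext x; rfl))
    (fun φ => by ext a x; rfl)

/-- Local cohomology in positive degrees vanishes on modules that vanish above some degree. -/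
theorem isZero_localCohomology_of_subsingleton [NeZero m] (V : FIModule k m) (b : FIPow m)
    (hV : ∀ a, ¬ notAbove b a → Subsingleton (V.obj a)) (n : ℕ) :
    IsZero ((localCohomology k m (n + 1)).obj V) := by
  let G := extendByZero (k := k) (notAbove b) (notAbove_of_hom b)
  have := enoughInjectives_functor_moduleCat k (notAbove b).FullSubcategory
  have := isIso_unit_app_of_isZero _ (notAbove_of_hom b) V hV
  refine IsZero.of_iso ?_ ((localCohomology k m (n + 1)).mapIso
    (asIso ((restrictExtendByZeroAdjunction (notAbove b) (notAbove_of_hom b)).unit.app V)))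
  exact Functor.isZero_rightDerived_succ_obj_of_comp_iso G
    (injective_extendByZero_obj _ _) (torsionFunctor k m) G (extendByZeroTorsionIso k b) _ n

/-- A finitely generated torsion module vanishes in all sufficiently large degrees. -/
theorem IsFinitelyGenerated.exists_subsingleton_of_isTorsion {V : FIModule k m}
    (hfg : IsFinitelyGenerated V) (htors : IsTorsion V) :
    ∃ b : FIPow m, ∀ a, ¬ notAbove b a → Subsingleton (V.obj a) := by
  obtain ⟨S, hS, hgen⟩ := hfg
  choose c f _ hf using fun s : Σ a : FIPow m, V.obj a => htors s.1 s.2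
  let b : FIPow m := fun j => ⟨∑ s ∈ hS.toFinset, (c s j).card⟩
  have hb : ∀ s ∈ S, ∀ j, (c s j).card ≤ (b j).card := fun s hs j =>
    Finset.single_le_sum (f := fun s => (c s j).card) (fun _ _ => Nat.zero_le _)
      (hS.mem_toFinset.2 hs)
  -- The elements killed by every morphism to a degree above `b`. They form a submodule containing
  -- the generators, hence all of `V`.
  let W (a : FIPow m) : Submodule k (V.obj a) :=
    ⨅ (d : FIPow m) (_ : ∀ j, (b j).card ≤ (d j).card) (g : a ⟶ d), LinearMap.ker (V.map g).hom
  have hW (a : FIPow m) (v : V.obj a) : v ∈ W a ↔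
      ∀ d : FIPow m, (∀ j, (b j).card ≤ (d j).card) → ∀ g : a ⟶ d, (V.map g).hom v = 0 := by
    simp [W]
  have htop := hgen W
    (fun a a' g v hv => (hW _ _).2 fun d hd g' => by
      simpa using (hW _ _).1 hv d hd (g ≫ g'))
    (fun s hs => (hW _ _).2 fun d hd g =>
      map_eq_zero_of_le V (f s) (hf s) (fun j => (hb s hs j).trans (hd j)) g)
  refine ⟨b, fun a ha => subsingleton_of_forall_eq 0 fun v => ?_⟩
  have hv : v ∈ W a := htop a ▸ Submodule.mem_top
  -- As `a` is itself above `b`, the identity already kills `v`.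
  simpa using (hW _ _).1 hv a (not_not.1 ha) (𝟙 a)

end FIModule

theorem mainTheorem8 (k : Type u) [CommRing k] [IsNoetherianRing k] (m : ℕ) [NeZero m]
    (V : FIModule k m) (hfg : FIModule.IsFinitelyGenerated V) (htors : FIModule.IsTorsion V)
    (i : ℕ) (hi : 1 ≤ i) :
    IsZero ((FIModule.localCohomology k m i).obj V) := by
  obtain ⟨b, hb⟩ := hfg.exists_subsingleton_of_isTorsion htors
  obtain ⟨n, rfl⟩ := Nat.exists_eq_add_of_le' hi
  exact FIModule.isZero_localCohomology_of_subsingleton V b hb n
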